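/- Let $X$ be a complex Banach space and let $T$ be a bounded linear operator on $X$, with spectrum $\sigma(T)$. For a bounded operator $S$ on a normed space, $\mathcal{N}(S)$ and $\mathcal{R}(S)$ denote its kernel and range. $S$ is called upper semi-Fredholm if $\mathcal{R}(S)$ is closed and $\dim\mathcal{N}(S)<\infty$, and upper semi-B-Fredholm if for some integer $n\ge 0$ the range $\mathcal{R}(S^n)$ is closed and the restriction of $S$ to $\mathcal{R}(S^n)$, viewed as an operator from $\mathcal{R}(S^n)$ into itself, is upper semi-Fredholm. Define: - $\sigma_a(T)=\{\lambda\in\mathbb{C}: T-\lambda I \text{ is not bounded below}\}$, the approximate point spectrum; - $\sigma_{uf}(T)$ and $\sigma_{ubf}(T)$, the sets of all $\lambda\in\mathbb{C}$ for which $T-\lambda I$ is not upper semi-Fredholm, respectively not upper semi-B-Fredholm; - $\Delta_{uf}(T)=\sigma_a(T)\setminus\sigma_{uf}(T)$ and $\Delta_{uf}^g(T)=\sigma_a(T)\setminus\sigma_{ubf}(T)$; - $\pi_0(T)$, the set of isolated points of $\sigma(T)$ that are eigenvalues of $T$, and $\pi_{00}(T)=\{\lambda\in\pi_0(T):\dim\mathcal{N}(T-\lambda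 I)<\infty\}$; - $p_0(T)$, the set of poles of $T$, i.e. of those $\lambda\in\sigma(T)$ for which $T-\lambda I$ is Drazin invertible (has finite ascent and finite descent: $\mathcal{N}((T-\lambda I)^n)=\mathcal{N}((T-\lambda I)^{n+1})$ for some $n\ge 0$ and $\mathcal{R}((T-\lambda I)^m)=\mathcal{R}((T-\lambda I)^{m+1})$ for some $m\ge 0$), and $p_{00}(T)=\{\lambda\in p_0(T):\dim\mathcal{N}(T-\lambda I)<\infty\}$, the set of poles of finite rank. The operator $T$ satisfies property $(w_{\pi_{00}})$ if $\Delta_{uf}(T)=\pi_{00}(T)$, property $(gw_{\pi_{00}})$ if $\Delta_{uf}^g(T)=\pi_0(T)$, property $(bz_1)$ if $\Delta_{uf}(T)=p_{00}(T)$, and property $(gbz_1)$ if $\Delta_{uf}^g(T)=p_0(T)$. Then the following hold. (i) $T$ satisfies $(w_{\pi_{00}})$ if and only if $T$ satisfies $(bz_1)$ and $\pi_{00}(T)=p_{00}(T)$. (ii) $T$ satisfies $(gw_{\pi_{00}})$ if and only if $T$ satisfies $(gbz_1)$ and $\pi_0(T)=p_0(T)$. -/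

import Mathlib

open Topology Filter

noncomputable section

namespace BddOp

/-- `T` is upper semi-Fredholm: closed range and finite-dimensional kernel. -/
def IsUpperSemiFredholm {E : Type*} [NormedAddCommGroup E] [NormedSpace ℂ E]
    (T : E →L[ℂ] E) : Prop :=
  IsClosed (T.range : Set E) ∧ FiniteDimensional ℂ T.ker

/-- `T_[n]`: the restriction of `T` to the range of `T ^ n`, as a map of that range into itself. -/
def restrictRangePow {E : Type*} [NormedAddCommGroup E] [NormedSpace ℂ E]
    (T : E →L[ℂ] E) (n : ℕ) : (T ^ n).range →L[ℂ] (T ^ n).range :=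
  T.restrict (p := (T ^ n).range) (q := (T ^ n).range) (by
    rintro _ ⟨y, rfl⟩
    refine ⟨T y, ?_⟩
    change (T ^ n * T) y = (T * T ^ n) y
    rw [← pow_succ, ← pow_succ'])

/-- `T` is upper semi-B-Fredholm: for some `n ≥ 0` the range of `T ^ n` is closed and the
restriction `T_[n]` is upper semi-Fredholm. -/
def IsUpperSemiBFredholm {E : Type*} [NormedAddCommGroup E] [NormedSpace ℂ E]
    (T : E →L[ℂ] E) : Prop :=
  ∃ n : ℕ, IsClosed ((T ^ n).range : Set E) ∧ IsUpperSemiFredholm (restrictRangePow T n)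

/-- `T` is bounded below. -/
def IsBoundedBelow {E : Type*} [NormedAddCommGroup E] [NormedSpace ℂ E]
    (T : E →L[ℂ] E) : Prop :=
  ∃ c : ℝ, 0 < c ∧ ∀ x : E, c * ‖x‖ ≤ ‖T x‖

/-- `T` has finite ascent. -/
def HasFiniteAscent {E : Type*} [NormedAddCommGroup E] [NormedSpace ℂ E]
    (T : E →L[ℂ] E) : Prop :=
  ∃ n : ℕ, (T ^ n).ker = (T ^ (n + 1)).ker

/-- `T` has finite descent. -/
def HasFiniteDescent {E : Type*} [NormedAddCommGroup E] [NormedSpace ℂ E]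
    (T : E →L[ℂ] E) : Prop :=
  ∃ n : ℕ, (T ^ n).range = (T ^ (n + 1)).range

/-- `T` is Drazin invertible: finite ascent and finite descent. -/
def IsDrazinInvertible {E : Type*} [NormedAddCommGroup E] [NormedSpace ℂ E]
    (T : E →L[ℂ] E) : Prop :=
  HasFiniteAscent T ∧ HasFiniteDescent T

/-- The isolated points of a set of complex numbers. -/
def iso (A : Set ℂ) : Set ℂ := {z | z ∈ A ∧ ¬ AccPt z (𝓟 A)}

section Spectra

variable {X : Type*} [NormedAddCommGroup X] [NormedSpace ℂ X]

/-- The operator `T - λ I`. -/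
def shift (T : X →L[ℂ] X) (z : ℂ) : X →L[ℂ] X := T - z • (1 : X →L[ℂ] X)

/-- The approximate point spectrum `σ_a(T)`. -/
def approxSpectrum (T : X →L[ℂ] X) : Set ℂ := {z | ¬ IsBoundedBelow (shift T z)}

/-- The upper semi-Fredholm spectrum `σ_uf(T)`. -/
def upperSemiFredholmSpectrum (T : X →L[ℂ] X) : Set ℂ :=
  {z | ¬ IsUpperSemiFredholm (shift T z)}

/-- The upper semi-B-Fredholm spectrum `σ_ubf(T)`. -/
def upperSemiBFredholmSpectrum (T : X →L[ℂ] X) : Set ℂ :=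
  {z | ¬ IsUpperSemiBFredholm (shift T z)}

/-- The Drazin spectrum `σ_d(T)`. -/
def drazinSpectrum (T : X →L[ℂ] X) : Set ℂ := {z | ¬ IsDrazinInvertible (shift T z)}

/-- The eigenvalues `σ_p(T)`. -/
def eigenvalues (T : X →L[ℂ] X) : Set ℂ := {z | (shift T z).ker ≠ ⊥}

/-- The eigenvalues of finite (geometric) multiplicity `σ_p^f(T)`. -/
def finiteEigenvalues (T : X →L[ℂ] X) : Set ℂ :=
  {z | z ∈ eigenvalues T ∧ FiniteDimensional ℂ (shift T z).ker}

/-- The poles `p_0(T) = σ(T) \ σ_d(T)`. -/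
def poles (T : X →L[ℂ] X) : Set ℂ := spectrum ℂ T \ drazinSpectrum T

/-- The poles of finite rank `p_00(T)`: the poles `λ` with `dim ker (T - λ I) < ∞`. -/
def finitePoles (T : X →L[ℂ] X) : Set ℂ :=
  {z | z ∈ poles T ∧ FiniteDimensional ℂ (shift T z).ker}

/-- `π_0(T)`: the isolated points of the spectrum that are eigenvalues. -/
def isoEigenvalues (T : X →L[ℂ] X) : Set ℂ := iso (spectrum ℂ T) ∩ eigenvalues T

/-- `π_00(T)`: the isolated points of the spectrum that are eigenvalues of finite multiplicity. -/
def isoFiniteEigenvalues (T : X →L[ℂ] X) : Set ℂ :=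
  iso (spectrum ℂ T) ∩ finiteEigenvalues T

/-- `Δ_uf(T) = σ_a(T) \ σ_uf(T)`. -/
def deltaUF (T : X →L[ℂ] X) : Set ℂ := approxSpectrum T \ upperSemiFredholmSpectrum T

/-- `Δ_uf^g(T) = σ_a(T) \ σ_ubf(T)`. -/
def deltaUFg (T : X →L[ℂ] X) : Set ℂ := approxSpectrum T \ upperSemiBFredholmSpectrum T

/-- Property `(bz_1)`. -/
def PropertyBz1 (T : X →L[ℂ] X) : Prop := deltaUF T = finitePoles T

/-- Property `(gbz_1)`. -/
def PropertyGbz1 (T : X →L[ℂ] X) : Prop := deltaUFg T = poles T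

/-- Property `(w_{π_00})`. -/
def PropertyWPi00 (T : X →L[ℂ] X) : Prop := deltaUF T = isoFiniteEigenvalues T

/-- Property `(gw_{π_00})`. -/
def PropertyGwPi00 (T : X →L[ℂ] X) : Prop := deltaUFg T = isoEigenvalues T

end Spectra

end BddOp

end

namespace BddOp

variable {E : Type*} [NormedAddCommGroup E] [NormedSpace ℂ E]

/-! Poles are always isolated eigenvalues, so both parts reduce to one claim: if `S` is upper
semi-(B-)Fredholm and `S - z` is bijective for small `z ≠ 0`, then `S` is Drazin invertible. In the
Fredholm case, suppose `ker S` met every `R(S^k)` nontrivially. The intersection of these ranges is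
closed and mapped onto itself by `S`, and it would contain a kernel vector; a power series built on
that vector gives eigenvectors for all small `z`, a contradiction. Hence `ker S ∩ R(S^K) = 0` for
some `K`, which bounds the ascent, and solving `(S - z)x = y` as `z → 0` bounds the descent. The
B-Fredholm case follows by restricting to `R(S^n)`. -/

theorem range_pow_succ (S : E →L[ℂ] E) (n : ℕ) :
    (S ^ (n + 1)).range = (S ^ n).range.map (S : E →ₗ[ℂ] E) := by
  ext y
  simp only [LinearMap.mem_range, Submodule.mem_map, pow_succ']
  constructor
  · rintro ⟨x, rfl⟩
    exact ⟨_, ⟨x, rfl⟩, rfl⟩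
  · rintro ⟨_, ⟨x, rfl⟩, rfl⟩
    exact ⟨x, rfl⟩

theorem range_pow_antitone (S : E →L[ℂ] E) : Antitone fun n : ℕ => (S ^ n).range := by
  refine antitone_nat_of_succ_le fun n => ?_
  rintro _ ⟨x, rfl⟩
  exact ⟨S x, by rw [pow_succ]; rfl⟩

theorem ker_pow_monotone (S : E →L[ℂ] E) : Monotone fun n : ℕ => (S ^ n).ker := by
  refine monotone_nat_of_le_succ fun n x hx => ?_
  have hx : (S ^ n) x = 0 := hx
  change (S ^ (n + 1)) x = 0
  rw [pow_succ', mul_apply_eq_comp, hx, map_zero]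

/-! ### Semi-Fredholm operators at isolated spectral points -/

/-- An upper semi-Fredholm operator maps closed subspaces to closed subspaces. -/
theorem IsUpperSemiFredholm.isClosed_map [CompleteSpace E] {S : E →L[ℂ] E}
    (hS : IsUpperSemiFredholm S) {F : Submodule ℂ E} (hF : IsClosed (F : Set E)) :
    IsClosed (F.map (S : E →ₗ[ℂ] E) : Set E) := by
  have := hS.2
  have : CompleteSpace S.range := hS.1.completeSpace_coe
  have hq : IsQuotientMap S.rangeRestrict :=
    S.rangeRestrict.isQuotientMap (LinearMap.surjective_rangeRestrict (S : E →ₗ[ℂ] E))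
  -- `F + ker S` is the preimage of `S(F)` under the quotient map onto `R(S)`.
  have hsup : IsClosed ((F ⊔ S.ker : Submodule ℂ E) : Set E) :=
    Submodule.isClosed_sup_finiteDimensional _ _ hF
  have hpre : IsClosed (((↑) : S.range → E) ⁻¹' (F.map (S : E →ₗ[ℂ] E) : Set E)) := by
    rw [← hq.isClosed_preimage]
    rw [← Submodule.comap_map_eq] at hsup
    exact hsup
  have himg := hS.1.isClosedEmbedding_subtypeVal.isClosedMap _ hpre
  convert himg using 1
  ext y
  constructor
  · rintro ⟨x, hx, rfl⟩
    exact ⟨⟨S x, x, rfl⟩, ⟨x, hx, rfl⟩, rfl⟩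
  · rintro ⟨y, hy, rfl⟩
    exact hy

theorem IsUpperSemiFredholm.isClosed_range_pow [CompleteSpace E] {S : E →L[ℂ] E}
    (hS : IsUpperSemiFredholm S) (n : ℕ) : IsClosed ((S ^ n).range : Set E) := by
  induction n with
  | zero =>
    have : ((S ^ 0).range : Set E) = Set.univ := Set.eq_univ_of_forall fun x => ⟨x, rfl⟩
    rw [this]
    exact isClosed_univ
  | succ n ih =>
    rw [range_pow_succ]
    exact hS.isClosed_map ih

/-- The subspaces `ker S ∩ R(S^n)` decrease inside a finite-dimensional space. -/
theorem exists_ker_inf_range_pow_stable (S : E →L[ℂ] E) [FiniteDimensional ℂ S.ker] :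
    ∃ K : ℕ, ∀ k, K ≤ k → ∀ x, S x = 0 → x ∈ (S ^ K).range → x ∈ (S ^ k).range := by
  let f : ℕ →o (Submodule ℂ S.ker)ᵒᵈ :=
    ⟨fun n => OrderDual.toDual ((S ^ n).range.comap S.ker.subtype),
      fun m n h => Submodule.comap_mono (range_pow_antitone S h)⟩
  obtain ⟨K, hK⟩ := IsArtinian.monotone_stabilizes f
  refine ⟨K, fun k hk x hx hxK => ?_⟩
  have h : (S ^ K).range.comap S.ker.subtype = (S ^ k).range.comap S.ker.subtype := hK k hk
  have h1 : (⟨x, hx⟩ : S.ker) ∈ (S ^ K).range.comap S.ker.subtype := hxK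
  rw [h] at h1
  exact h1

/-- If `S` maps a complete subspace onto itself and has a nonzero kernel vector there, then so does
every small perturbation `S - z`. -/
theorem eventually_exists_eigenvector (S : E →L[ℂ] E) (M : Submodule ℂ E) [CompleteSpace M]
    (hM : ∀ x ∈ M, S x ∈ M) (hsurj : ∀ y ∈ M, ∃ x ∈ M, S x = y) {v : E} (hv : v ∈ M)
    (hv0 : v ≠ 0) (hSv : S v = 0) :
    ∀ᶠ z : ℂ in 𝓝 0, ∃ x, x ≠ 0 ∧ shift S z x = 0 := by
  let R : M →L[ℂ] M := S.restrict hM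
  have hR : Function.Surjective R := fun y => by
    obtain ⟨x, hx, hxy⟩ := hsurj y y.2
    exact ⟨⟨x, hx⟩, Subtype.ext hxy⟩
  -- The open mapping theorem gives a backward orbit `u k` of `v` with geometric growth; the
  -- eigenvector is `∑ z^k u_k`.
  obtain ⟨C, hC, hpre⟩ := R.exists_preimage_norm_le hR
  choose g hg hgn using hpre
  let u : ℕ → M := fun k => g^[k] ⟨v, hv⟩
  have hu0 : u 0 = ⟨v, hv⟩ := rfl
  have hus (k : ℕ) : R (u (k + 1)) = u k := by
    simp only [u, Function.iterate_succ_apply']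
    exact hg _
  have hun (k : ℕ) : ‖u k‖ ≤ C ^ k * ‖v‖ := by
    induction k with
    | zero => simp [hu0]
    | succ k ih =>
      calc ‖u (k + 1)‖ = ‖g (u k)‖ := by simp only [u, Function.iterate_succ_apply']
        _ ≤ C * ‖u k‖ := hgn _
        _ ≤ C * (C ^ k * ‖v‖) := by gcongr
        _ = C ^ (k + 1) * ‖v‖ := by ring
  have hev : ∀ᶠ z : ℂ in 𝓝 0, C * ‖z‖ < 1 / 2 := by
    have : Tendsto (fun z : ℂ => C * ‖z‖) (𝓝 0) (𝓝 (C * ‖(0 : ℂ)‖)) := by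
      apply Continuous.tendsto; fun_prop
    apply this.eventually_lt_const
    simp
  filter_upwards [hev] with z hz
  have hr0 : 0 ≤ C * ‖z‖ := by positivity
  have hbound (k : ℕ) : ‖z ^ k • u k‖ ≤ ‖v‖ * (C * ‖z‖) ^ k := by
    rw [norm_smul, norm_pow]
    calc ‖z‖ ^ k * ‖u k‖ ≤ ‖z‖ ^ k * (C ^ k * ‖v‖) := by gcongr; exact hun k
      _ = ‖v‖ * (C * ‖z‖) ^ k := by rw [mul_pow]; ring
  have hgeo : Summable fun k : ℕ => ‖v‖ * (C * ‖z‖) ^ k :=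
    (summable_geometric_of_lt_one hr0 (by linarith)).mul_left _
  have hsum : Summable fun k : ℕ => z ^ k • u k := Summable.of_norm_bounded hgeo hbound
  have hdec : ∑' k, z ^ k • u k = ⟨v, hv⟩ + ∑' k, z ^ (k + 1) • u (k + 1) := by
    rw [hsum.tsum_eq_zero_add]; simp [hu0]
  have hRs : R (∑' k, z ^ k • u k) = z • ∑' k, z ^ k • u k := by
    have hsum' := (summable_nat_add_iff 1).2 hsum
    have hRv : R ⟨v, hv⟩ = 0 := Subtype.ext hSv
    conv_lhs => rw [hdec, map_add, hRv, zero_add, R.map_tsum hsum']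
    rw [← hsum.tsum_const_smul]
    refine tsum_congr fun k => ?_
    rw [map_smul, hus, smul_smul, pow_succ']
  refine ⟨((∑' k, z ^ k • u k : M) : E), fun h0 => ?_, ?_⟩
  · have h0 : ∑' k, z ^ k • u k = 0 := Subtype.ext h0
    rw [hdec] at h0
    -- With `r = C‖z‖ < 1/2` the tail has norm at most `‖v‖ r / (1 - r) < ‖v‖`, so it cannot cancel
    -- `v`.
    have hle : ‖∑' k, z ^ (k + 1) • u (k + 1)‖ ≤ ∑' k : ℕ, ‖v‖ * (C * ‖z‖) ^ (k + 1) :=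
      tsum_of_norm_bounded ((summable_nat_add_iff 1).2 hgeo).hasSum fun k => hbound (k + 1)
    have hval : ∑' k : ℕ, ‖v‖ * (C * ‖z‖) ^ (k + 1) = ‖v‖ * (C * ‖z‖) * (1 - C * ‖z‖)⁻¹ := by
      rw [← tsum_geometric_of_lt_one hr0 (by linarith), ← tsum_mul_left]
      exact tsum_congr fun k => by ring
    have hvn : ‖v‖ = ‖∑' k, z ^ (k + 1) • u (k + 1)‖ := by
      rw [← norm_neg (∑' k, z ^ (k + 1) • u (k + 1)), ← eq_neg_of_add_eq_zero_left h0]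
      rfl
    rw [hval, ← hvn] at hle
    have hvpos : 0 < ‖v‖ := norm_pos_iff.2 hv0
    have h1 : 0 < 1 - C * ‖z‖ := by linarith
    rw [← div_eq_mul_inv, le_div_iff₀ h1] at hle
    nlinarith
  · have h := congrArg (Subtype.val : M → E) hRs
    change S _ - z • _ = 0
    rw [sub_eq_zero]
    exact h

/-- An upper semi-Fredholm operator whose small perturbations `S - z`, `z ≠ 0`, are bijective has
a power whose range meets the kernel trivially. -/
theorem IsUpperSemiFredholm.exists_disjoint_ker_range_pow [CompleteSpace E] {S : E →L[ℂ] E}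
    (hS : IsUpperSemiFredholm S)
    (hbij : ∀ᶠ z : ℂ in 𝓝[≠] 0, Function.Bijective (shift S z)) :
    ∃ K : ℕ, ∀ x, S x = 0 → x ∈ (S ^ K).range → x = 0 := by
  have := hS.2
  obtain ⟨K, hK⟩ := exists_ker_inf_range_pow_stable S
  refine ⟨K, fun v hv hvK => by_contra fun hv0 => ?_⟩
  let M : Submodule ℂ E := ⨅ k, (S ^ k).range
  have memM {x : E} : x ∈ M ↔ ∀ k, x ∈ (S ^ k).range := Submodule.mem_iInf _
  have hMc : IsClosed (M : Set E) := by
    rw [Submodule.coe_iInf]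
    exact isClosed_iInter hS.isClosed_range_pow
  have : CompleteSpace M := hMc.completeSpace_coe
  have stable {x : E} (hx : S x = 0) (hxK : x ∈ (S ^ K).range) : x ∈ M :=
    memM.2 fun k => (le_total K k).elim (fun h => hK k h x hx hxK)
      fun h => range_pow_antitone S h hxK
  have hM : ∀ x ∈ M, S x ∈ M := fun x hx => memM.2 fun k => by
    refine range_pow_antitone S (Nat.le_succ k) ?_
    change S x ∈ (S ^ (k + 1)).range
    rw [range_pow_succ]
    exact ⟨x, memM.1 hx k, rfl⟩
  have hsurj : ∀ y ∈ M, ∃ x ∈ M, S x = y := fun y hy => by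
    have hpre (k : ℕ) : ∃ x ∈ (S ^ k).range, S x = y := by
      have := memM.1 hy (k + 1)
      rw [range_pow_succ] at this
      exact this
    obtain ⟨x, hxK, hx⟩ := hpre K
    refine ⟨x, memM.2 fun k => ?_, hx⟩
    -- Two preimages of `y` in `R(S^K)` differ by a kernel vector there, which lies in `M`; so `x`
    -- is as deep as `w`.
    obtain ⟨w, hwk, hw⟩ := hpre (max K k)
    have hd : x - w ∈ M := stable (by rw [map_sub, hx, hw, sub_self])
      (sub_mem hxK (range_pow_antitone S (le_max_left K k) hwk))
    rw [← sub_add_cancel x w]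
    exact add_mem (memM.1 hd k) (range_pow_antitone S (le_max_right K k) hwk)
  have hev := (eventually_exists_eigenvector S M hM hsurj (stable hv hvK) hv0 hv).filter_mono
    (nhdsWithin_le_nhds (s := {0}ᶜ))
  obtain ⟨z, hz, x, hx0, hx⟩ := (hbij.and hev).exists
  exact hx0 (hz.1 (hx.trans (map_zero _).symm))

theorem shift_commute_pow (S : E →L[ℂ] E) (z : ℂ) (n : ℕ) :
    Commute (shift S z) (S ^ n) := by
  refine Commute.pow_right (Commute.sub_left (Commute.refl S) ?_) n
  exact (Commute.one_left S).smul_left z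

theorem exists_mem_range_pow_shift_eq {S : E →L[ℂ] E} {z : ℂ}
    (hz : Function.Bijective (shift S z)) {n : ℕ} {y : E} (hy : y ∈ (S ^ n).range) :
    ∃ x ∈ (S ^ n).range, shift S z x = y := by
  obtain ⟨w, rfl⟩ := hy
  obtain ⟨x, rfl⟩ := hz.2 w
  refine ⟨(S ^ n) x, ⟨x, rfl⟩, ?_⟩
  exact congrArg (fun A : E →L[ℂ] E => A x) (shift_commute_pow S z n).eq

theorem IsUpperSemiFredholm.isDrazinInvertible [CompleteSpace E] {S : E →L[ℂ] E}
    (hS : IsUpperSemiFredholm S)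
    (hbij : ∀ᶠ z : ℂ in 𝓝[≠] 0, Function.Bijective (shift S z)) :
    IsDrazinInvertible S := by
  obtain ⟨K, hK⟩ := hS.exists_disjoint_ker_range_pow hbij
  refine ⟨⟨K, le_antisymm (ker_pow_monotone S K.le_succ) fun x hx => ?_⟩,
    ⟨K, le_antisymm (fun y hy => ?_) (range_pow_antitone S K.le_succ)⟩⟩
  · have hx : (S ^ (K + 1)) x = 0 := hx
    rw [pow_succ'] at hx
    exact hK _ hx ⟨x, rfl⟩
  · have hMc := hS.isClosed_range_pow K
    have : CompleteSpace (S ^ K).range := hMc.completeSpace_coe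
    let A : (S ^ K).range →L[ℂ] E := S.comp (S ^ K).range.subtypeL
    have hAinj : Function.Injective A := (injective_iff_map_eq_zero A).2 fun x hx =>
      Subtype.ext (hK x hx x.2)
    have hArange : (A.range : Set E) = (S ^ (K + 1)).range := by
      rw [range_pow_succ]
      ext w
      constructor
      · rintro ⟨x, rfl⟩
        exact ⟨x, x.2, rfl⟩
      · rintro ⟨x, hx, rfl⟩
        exact ⟨⟨x, hx⟩, rfl⟩
    have hcl := hS.isClosed_range_pow (K + 1)
    obtain ⟨c, hc⟩ := A.antilipschitz_of_injective_of_isClosed_range hAinj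
      (by have := hcl; rw [← hArange] at this; exact this)
    have hbd : ∀ x ∈ (S ^ K).range, ‖x‖ ≤ c * ‖S x‖ := fun x hx => by
      have := hc.le_mul_dist ⟨x, hx⟩ 0
      simpa [A] using this
    rw [← SetLike.mem_coe, ← hcl.closure_eq, Metric.mem_closure_iff]
    intro ε hε
    -- The first bound absorbs `c‖z‖‖x‖` into `‖x‖/2`, giving `‖x‖ ≤ 2c‖y‖`; the second then makes
    -- `S x - y = z x` shorter than `ε`.
    have hsmall : ∀ᶠ z : ℂ in 𝓝[≠] 0, c * ‖z‖ < 1 / 2 ∧ ‖z‖ * (2 * c * ‖y‖) < ε := by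
      refine Filter.Eventually.filter_mono nhdsWithin_le_nhds (Filter.Eventually.and ?_ ?_)
      · have : Tendsto (fun z : ℂ => c * ‖z‖) (𝓝 0) (𝓝 (c * ‖(0 : ℂ)‖)) := by
          apply Continuous.tendsto; fun_prop
        exact this.eventually_lt_const (by simp)
      · have : Tendsto (fun z : ℂ => ‖z‖ * (2 * c * ‖y‖)) (𝓝 0)
            (𝓝 (‖(0 : ℂ)‖ * (2 * c * ‖y‖))) := by
          apply Continuous.tendsto; fun_prop
        exact this.eventually_lt_const (by simpa using hε)
    obtain ⟨z, hz, hz1, hz2⟩ := (hbij.and hsmall).exists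
    obtain ⟨x, hxK, hx⟩ := exists_mem_range_pow_shift_eq hz hy
    have hSx : S x = y + z • x := by
      rw [← hx]; simp [shift]
    refine ⟨S x, ?_, ?_⟩
    · rw [range_pow_succ]
      exact ⟨x, hxK, rfl⟩
    · have h1 := hbd x hxK
      have h2 : ‖S x‖ ≤ ‖y‖ + ‖z‖ * ‖x‖ := by
        rw [hSx, ← norm_smul]; exact norm_add_le _ _
      have h3 : ‖x‖ ≤ 2 * c * ‖y‖ := by
        have h4 : (c : ℝ) * ‖S x‖ ≤ c * (‖y‖ + ‖z‖ * ‖x‖) := by gcongr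
        nlinarith [norm_nonneg x]
      rw [hSx, dist_eq_norm, sub_add_cancel_left, norm_neg, norm_smul]
      exact (mul_le_mul_of_nonneg_left h3 (norm_nonneg z)).trans_lt hz2

/-! ### Restriction to the range of a power -/

theorem coe_restrictRangePow_pow (S : E →L[ℂ] E) (n k : ℕ) (x : (S ^ n).range) :
    (((restrictRangePow S n) ^ k) x : E) = (S ^ k) (x : E) := by
  induction k with
  | zero => rfl
  | succ k ih =>
    rw [pow_succ', pow_succ', mul_apply_eq_comp, mul_apply_eq_comp, ← ih]
    rfl

theorem bijective_shift_restrictRangePow {S : E →L[ℂ] E} {z : ℂ}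
    (hz : Function.Bijective (shift S z)) (n : ℕ) :
    Function.Bijective (shift (restrictRangePow S n) z) := by
  constructor
  · intro x y hxy
    exact Subtype.ext (hz.1 (congrArg Subtype.val hxy))
  · intro y
    obtain ⟨x, hx, hxy⟩ := exists_mem_range_pow_shift_eq hz y.2
    exact ⟨⟨x, hx⟩, Subtype.ext hxy⟩

theorem isDrazinInvertible_of_restrictRangePow {S : E →L[ℂ] E} {n : ℕ}
    (h : IsDrazinInvertible (restrictRangePow S n)) : IsDrazinInvertible S := by
  obtain ⟨⟨p, hp⟩, ⟨q, hq⟩⟩ := h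
  refine ⟨⟨p + n, le_antisymm (ker_pow_monotone S (Nat.le_succ _)) fun x hx => ?_⟩,
    ⟨q + n, le_antisymm ?_ (range_pow_antitone S (Nat.le_succ _))⟩⟩
  · have hx : (S ^ (p + n + 1)) x = 0 := hx
    have h1 : (⟨(S ^ n) x, x, rfl⟩ : (S ^ n).range) ∈ ((restrictRangePow S n) ^ (p + 1)).ker := by
      refine Subtype.ext ((coe_restrictRangePow_pow S n (p + 1) _).trans ?_)
      rw [← mul_apply_eq_comp, ← pow_add, add_right_comm]
      exact hx
    rw [← hp] at h1
    have h2 := (coe_restrictRangePow_pow S n p _).symm.trans (congrArg Subtype.val h1)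
    rw [← mul_apply_eq_comp, ← pow_add] at h2
    exact h2
  · rintro _ ⟨x, rfl⟩
    have h1 : ((restrictRangePow S n) ^ q) ⟨(S ^ n) x, x, rfl⟩ ∈
        ((restrictRangePow S n) ^ q).range := ⟨_, rfl⟩
    rw [hq] at h1
    obtain ⟨⟨_, w, rfl⟩, hw⟩ := h1
    refine ⟨w, ?_⟩
    have h2 := (coe_restrictRangePow_pow S n (q + 1) ⟨(S ^ n) w, w, rfl⟩).symm.trans
      ((congrArg Subtype.val hw).trans (coe_restrictRangePow_pow S n q ⟨(S ^ n) x, x, rfl⟩))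
    rw [add_right_comm, pow_add S (q + 1) n, pow_add S q n]
    exact h2

theorem IsUpperSemiBFredholm.isDrazinInvertible [CompleteSpace E] {S : E →L[ℂ] E}
    (hS : IsUpperSemiBFredholm S)
    (hbij : ∀ᶠ z : ℂ in 𝓝[≠] 0, Function.Bijective (shift S z)) :
    IsDrazinInvertible S := by
  obtain ⟨n, hn, hF⟩ := hS
  have : CompleteSpace (S ^ n).range := hn.completeSpace_coe
  exact isDrazinInvertible_of_restrictRangePow
    (hF.isDrazinInvertible (hbij.mono fun z hz => bijective_shift_restrictRangePow hz n))

/-! ### Drazin invertible operators -/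

/-- The kernels and the ranges of the powers of a Drazin invertible operator stabilize at a common
exponent. -/
theorem IsDrazinInvertible.exists_pow {S : E →L[ℂ] E} (hS : IsDrazinInvertible S) :
    ∃ m : ℕ, (∀ k, m ≤ k → (S ^ k).ker = (S ^ m).ker) ∧
      ∀ k, m ≤ k → (S ^ k).range = (S ^ m).range := by
  obtain ⟨⟨p, hp⟩, ⟨q, hq⟩⟩ := hS
  have hker : ∀ k, p ≤ k → (S ^ k).ker = (S ^ p).ker := fun k hk => by
    induction k, hk using Nat.le_induction with
    | base => rfl
    | succ k hk ih =>
      rw [hp]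
      obtain ⟨j, rfl⟩ := Nat.exists_eq_add_of_le hk
      ext x
      have h := SetLike.ext_iff.1 ih (S x)
      simp only [LinearMap.mem_ker] at h ⊢
      rw [pow_succ S (p + j), pow_succ S p]
      exact h
  have hran : ∀ k, q ≤ k → (S ^ k).range = (S ^ q).range := fun k hk => by
    induction k, hk using Nat.le_induction with
    | base => rfl
    | succ k hk ih => rw [range_pow_succ, ih, ← range_pow_succ, ← hq]
  exact ⟨max p q,
    fun k hk => (hker k (le_of_max_le_left hk)).trans (hker _ (le_max_left _ _)).symm,
    fun k hk => (hran k (le_of_max_le_right hk)).trans (hran _ (le_max_right _ _)).symm⟩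

/-- Factoring through `E ⧸ ker f` gives an injective map whose range has a closed complement. -/
theorem isClosed_range_of_isCompl_ker [CompleteSpace E] (f : E →L[ℂ] E)
    (h : IsCompl f.range f.ker) : IsClosed (f.range : Set E) := by
  have hker : IsClosed (f.ker : Set E) := f.isClosed_ker
  obtain ⟨c, hc⟩ : ∃ c : (E ⧸ f.ker) →L[ℂ] E, ∀ x, c (Submodule.Quotient.mk x) = f x :=
    ⟨Submodule.liftQL f.ker f le_rfl, fun x => rfl⟩
  have hrange : c.range = f.range := by
    ext y
    constructor
    · rintro ⟨x, rfl⟩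
      obtain ⟨x, rfl⟩ := Submodule.Quotient.mk_surjective _ x
      exact ⟨x, (hc x).symm⟩
    · rintro ⟨x, rfl⟩
      exact ⟨Submodule.Quotient.mk x, hc x⟩
  have hinj : c.ker = ⊥ := by
    rw [LinearMap.ker_eq_bot']
    intro x hx
    obtain ⟨x, rfl⟩ := Submodule.Quotient.mk_surjective _ x
    exact (Submodule.Quotient.mk_eq_zero _).2 ((hc x).symm.trans hx)
  rw [← hrange]
  exact c.closed_complemented_range_of_isCompl_of_ker_eq_bot f.ker (by rwa [hrange]) hker hinj

/-- `E` splits as `R(S^m) ⊕ N(S^m)`, with `S` invertible on the first summand, an open condition,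
and nilpotent on the second. -/
theorem IsDrazinInvertible.eventually_bijective [CompleteSpace E] {S : E →L[ℂ] E}
    (hS : IsDrazinInvertible S) :
    ∀ᶠ z : ℂ in 𝓝[≠] 0, Function.Bijective (shift S z) := by
  obtain ⟨m, hker, hran⟩ := hS.exists_pow
  have memker {k : ℕ} {x : E} : x ∈ (S ^ k).ker ↔ (S ^ k) x = 0 := LinearMap.mem_ker
  have hadd (i j : ℕ) (x : E) : (S ^ (i + j)) x = (S ^ i) ((S ^ j) x) := by rw [pow_add]; rfl
  have hdecomp (x : E) : ∃ w, (S ^ m) (x - (S ^ m) w) = 0 := by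
    have : (S ^ m) x ∈ (S ^ (m + m)).range := by
      rw [hran (m + m) (Nat.le_add_left _ _)]; exact ⟨x, rfl⟩
    obtain ⟨w, hw⟩ := this
    refine ⟨w, ?_⟩
    rw [map_sub, ← hadd, sub_eq_zero]
    exact hw.symm
  have hcompl : IsCompl (S ^ m).range (S ^ m).ker := by
    constructor
    · rw [Submodule.disjoint_def]
      rintro _ ⟨x, rfl⟩ hx
      have : x ∈ (S ^ (m + m)).ker := memker.2 ((hadd m m x).trans hx)
      rw [hker (m + m) (Nat.le_add_left _ _)] at this
      exact this
    · rw [codisjoint_iff, Submodule.eq_top_iff']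
      intro x
      obtain ⟨w, hw⟩ := hdecomp x
      exact Submodule.mem_sup.2 ⟨(S ^ m) w, ⟨w, rfl⟩, _, hw, add_sub_cancel _ _⟩
  have : CompleteSpace (S ^ m).range := (isClosed_range_of_isCompl_ker _ hcompl).completeSpace_coe
  let R := restrictRangePow S m
  have hRbij : Function.Bijective R := by
    constructor
    · refine (injective_iff_map_eq_zero R).2 fun x hx => ?_
      obtain ⟨_, x, rfl⟩ := x
      have hx : S ((S ^ m) x) = 0 := congrArg Subtype.val hx
      have h1 : x ∈ (S ^ (m + 1)).ker := memker.2 (by rw [pow_succ']; exact hx)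
      rw [hker (m + 1) (Nat.le_succ _)] at h1
      exact Subtype.ext h1
    · rintro ⟨y, hy⟩
      rw [← hran (m + 1) (Nat.le_succ _), range_pow_succ] at hy
      obtain ⟨x, hx, rfl⟩ := hy
      exact ⟨⟨x, hx⟩, rfl⟩
  have hRz : ∀ᶠ z : ℂ in 𝓝 0, IsUnit (shift R z) := by
    have hcont : Continuous fun z : ℂ => shift R z := by unfold shift; fun_prop
    refine hcont.continuousAt.eventually (Units.isOpen.mem_nhds ?_)
    have : shift R 0 = R := by simp [shift]
    change IsUnit (shift R 0)
    rw [this]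
    exact ContinuousLinearMap.isUnit_iff_bijective.2 hRbij
  filter_upwards [hRz.filter_mono nhdsWithin_le_nhds, self_mem_nhdsWithin] with z hz hz0
  have hz0 : z ≠ 0 := hz0
  have hz := ContinuousLinearMap.isUnit_iff_bijective.1 hz
  constructor
  -- `S x = z x` with `z ≠ 0` forces `x = S^m (z^{-m} x)`, so `x` lies in the summand where `S - z`
  -- is injective.
  · refine (injective_iff_map_eq_zero _).2 fun x hx => ?_
    have hSx : S x = z • x := sub_eq_zero.1 hx
    have hpow (k : ℕ) : (S ^ k) x = z ^ k • x := by
      induction k with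
      | zero => simp
      | succ k ih => rw [pow_succ, mul_apply_eq_comp, hSx, map_smul, ih, smul_smul,
          pow_succ']
    have hxr : x ∈ (S ^ m).range := ⟨(z ^ m)⁻¹ • x, by
      change (S ^ m) _ = x
      rw [map_smul, hpow, inv_smul_smul₀ (pow_ne_zero _ hz0)]⟩
    have : (⟨x, hxr⟩ : (S ^ m).range) = 0 :=
      (injective_iff_map_eq_zero (shift R z)).1 hz.1 _ (Subtype.ext hx)
    exact congrArg Subtype.val this
  · have hnil (y : E) (hy : (S ^ m) y = 0) : ∃ x, shift S z x = y := by
      have hcomm : Commute S (z • (1 : E →L[ℂ] E)) := (Commute.one_right S).smul_right z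
      -- `S^m - z^m = (S - z) Q`, and the left side acts on `N(S^m)` as `-z^m`.
      obtain ⟨Q, hQ⟩ := hcomm.sub_dvd_pow_sub_pow m
      refine ⟨Q (-(z ^ m)⁻¹ • y), ?_⟩
      have h := congrArg (fun A : E →L[ℂ] E => A (-(z ^ m)⁻¹ • y)) hQ
      refine h.symm.trans ?_
      rw [sub_apply, map_smul, hy, smul_pow, one_pow, smul_apply, one_apply_eq_self, smul_zero,
        zero_sub, neg_smul, smul_neg, neg_neg, smul_inv_smul₀ (pow_ne_zero _ hz0)]
    intro y
    obtain ⟨w, hw⟩ := hdecomp y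
    obtain ⟨a, ha⟩ := hz.2 ⟨(S ^ m) w, w, rfl⟩
    obtain ⟨b, hb⟩ := hnil _ hw
    refine ⟨a + b, ?_⟩
    have ha : shift S z a = (S ^ m) w := congrArg Subtype.val ha
    rw [map_add, ha, hb, add_sub_cancel]

/-- Finite descent gives `S^q y = S^(q+1) x`; cancelling the injective `S^q` yields `y = S x`. -/
theorem IsDrazinInvertible.bijective_of_injective {S : E →L[ℂ] E} (hS : IsDrazinInvertible S)
    (hinj : Function.Injective S) : Function.Bijective S := by
  obtain ⟨-, q, hq⟩ := hS
  refine ⟨hinj, fun y => ?_⟩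
  have hy : (S ^ q) y ∈ (S ^ q).range := ⟨y, rfl⟩
  rw [hq] at hy
  obtain ⟨x, hx⟩ := hy
  refine ⟨x, ?_⟩
  have hpow : Function.Injective (S ^ q) := by
    have := hinj.iterate q
    rwa [← FunLike.coe_pow_eq_iterate] at this
  apply hpow
  refine Eq.trans ?_ hx
  rw [pow_succ]
  rfl

/-! ### Isolated spectral points and poles -/

section Spectra

variable {X : Type*} [NormedAddCommGroup X] [NormedSpace ℂ X]

theorem mem_spectrum_iff [CompleteSpace X] (T : X →L[ℂ] X) (z : ℂ) :
    z ∈ spectrum ℂ T ↔ ¬ Function.Bijective (shift T z) := by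
  rw [spectrum.mem_iff, Algebra.algebraMap_eq_smul_one, ← IsUnit.neg_iff, neg_sub,
    ContinuousLinearMap.isUnit_iff_bijective]
  rfl

theorem shift_shift (T : X →L[ℂ] X) (z w : ℂ) : shift (shift T z) w = shift T (z + w) := by
  simp only [shift, add_smul, sub_sub]

theorem mem_iso_spectrum_iff [CompleteSpace X] (T : X →L[ℂ] X) (z : ℂ) :
    z ∈ iso (spectrum ℂ T) ↔ z ∈ spectrum ℂ T ∧
      ∀ᶠ w : ℂ in 𝓝[≠] 0, Function.Bijective (shift (shift T z) w) := by
  refine and_congr_right fun _ => ?_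
  rw [accPt_iff_frequently_nhdsNE, not_frequently]
  simp only [mem_spectrum_iff, not_not, shift_shift]
  have : 𝓝[≠] z = map (z + ·) (𝓝[≠] 0) := by
    simp
  rw [this, eventually_map]

theorem poles_subset_isoEigenvalues [CompleteSpace X] (T : X →L[ℂ] X) : poles T ⊆ isoEigenvalues T := by
  rintro z ⟨hz, hd⟩
  have hd : IsDrazinInvertible (shift T z) := not_not.1 hd
  refine ⟨(mem_iso_spectrum_iff T z).2 ⟨hz, hd.eventually_bijective⟩, fun hker => ?_⟩
  exact (mem_spectrum_iff T z).1 hz (hd.bijective_of_injective (LinearMap.ker_eq_bot.1 hker))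

theorem finitePoles_subset_isoFiniteEigenvalues [CompleteSpace X]
    (T : X →L[ℂ] X) :
    finitePoles T ⊆ isoFiniteEigenvalues T := fun _ hz =>
  have h := poles_subset_isoEigenvalues T hz.1
  ⟨h.1, h.2, hz.2⟩

end Spectra

end BddOp

theorem mainTheorem6 {X : Type*} [NormedAddCommGroup X] [NormedSpace ℂ X] [CompleteSpace X]
    (T : X →L[ℂ] X) :
    (BddOp.PropertyWPi00 T ↔
      BddOp.PropertyBz1 T ∧ BddOp.isoFiniteEigenvalues T = BddOp.finitePoles T) ∧
    (BddOp.PropertyGwPi00 T ↔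
      BddOp.PropertyGbz1 T ∧ BddOp.isoEigenvalues T = BddOp.poles T) := by
  refine ⟨⟨fun h => ?_, fun h => h.1.trans h.2.symm⟩, ⟨fun h => ?_, fun h => h.1.trans h.2.symm⟩⟩
  · have heq : BddOp.isoFiniteEigenvalues T = BddOp.finitePoles T := by
      refine Set.Subset.antisymm (fun z hz => ?_) (BddOp.finitePoles_subset_isoFiniteEigenvalues T)
      obtain ⟨hs, hb⟩ := (BddOp.mem_iso_spectrum_iff T z).1 hz.1
      -- The property supplies the semi-Fredholm condition at `z`, isolation the bijectivity nearby.
      have hΔ : z ∈ BddOp.deltaUF T := by rw [h]; exact hz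
      have hF : BddOp.IsUpperSemiFredholm (BddOp.shift T z) := not_not.1 hΔ.2
      exact ⟨⟨hs, not_not.2 (hF.isDrazinInvertible hb)⟩, hF.2⟩
    exact ⟨h.trans heq, heq⟩
  · have heq : BddOp.isoEigenvalues T = BddOp.poles T := by
      refine Set.Subset.antisymm (fun z hz => ?_) (BddOp.poles_subset_isoEigenvalues T)
      obtain ⟨hs, hb⟩ := (BddOp.mem_iso_spectrum_iff T z).1 hz.1
      have hΔ : z ∈ BddOp.deltaUFg T := by rw [h]; exact hz
      have hF : BddOp.IsUpperSemiBFredholm (BddOp.shift T z) := not_not.1 hΔ.2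
      exact ⟨hs, not_not.2 (hF.isDrazinInvertible hb)⟩
    exact ⟨h.trans heq, heq⟩
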